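/- Let $G$ be a finite simple directed acyclic graph with vertex set $V$. For every vertex $i$ choose a word $\mathrm{pa}(i)$ over $V$ in which each parent of $i$ occurs exactly once and no other vertex occurs. Let $\mathbf{Cau}(G)$ be the free strict Markov category (strict symmetric monoidal category with a cocommutative comonoid structure, duplicate $\delta_A : A \to A\otimes A$ and discard $\epsilon_A : A \to \emptyset$, on every object $A$, compatible with $\otimes$, the discards being natural) whose objects are the words over $V$ (called variables), with concatenation as monoidal product and the empty word $\emptyset$ as unit, and whose morphisms are generated by the duplicates and discards and by one causal mechanism $\kappa_i : \mathrm{pa}(i) \to i$ for every vertex $i$. A variable is singular if no vertex occurs in it more than once; two variables are disjoint if no vertex occurs in both. For singular variables $t$ and $v$ let $G_{t\to v}$ be the subgraph of $G$ that consists of all vertices of $t$ and $v$ together with all the directed paths that end in $v$ and do not pass through or end in $t$ (starting in $t$ is allowed). The causal effect $[v\|t] : t \to v$ is the morphism of $\mathbf{Cau}(G)$ represented by the string diagram with one component $\Gamma_i$ for every vertex $i$ of $G_{t\to v}$: $\Gamma_i$ is $\kappa_i$ (omitted if $i\in t$) followed by the copying of $i$ into one wire for every child of $i$ in $G_{t\to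 v}$ and, if $i \in v$, one further output wire (so $i$ is discarded if there are none of these). The wire of $i$ for a child $j$ is connected to the input $i$ of $\kappa_j$; the input wires of the whole diagram are labelled by $t$, and its output wires by $v$. For sets $X, Y, Z$ of vertices, $X$ is forward-$t$-separated from $Y$ by $Z$ in $G$ if every directed path in $G$ from some $i\in X$ to some $j \in Y$ with $i\neq j$ that contains no vertex of $X\cup Y$ other than $i$ and $j$ contains some $k\in Z$. **Theorem.** Let $u$, $v$, $w$ be pairwise disjoint singular variables in $\mathbf{Cau}(G)$. Then $$[w\|vu] = \epsilon_v\otimes[w\|u]$$ (as morphisms $v\otimes u \to w$) if and only if $v$ is forward-$t$-separated from $w$ by $u$ in $G$. -/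

import Mathlib

open CategoryTheory MonoidalCategory ComonObj

universe u

/-! ### Causal graphs -/

/-- A simple directed acyclic graph on the vertex type `V`. -/
structure DAG (V : Type u) extends Digraph V where
  acyclic : ∀ i : V, ¬ Relation.TransGen Adj i i

namespace DAG

variable {V : Type u}

/-- The list of vertices `p` is a directed path with at least one arrow, starting from `i` and
ending at `j`. (In an acyclic graph the arrows of such a path are automatically distinct.) -/
structure IsDirectedPath (G : DAG V) (p : List V) (i j : V) : Prop where
  two_le : 2 ≤ p.length
  chain : p.IsChain G.Adj
  head : p.head? = some i
  last : p.getLast? = some j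

/-- A forward trek from `i` to `j`: a directed path between two distinct vertices. -/
def IsForwardTrek (G : DAG V) (p : List V) (i j : V) : Prop :=
  i ≠ j ∧ G.IsDirectedPath p i j

/-- A forward trek from some `i ∈ X` to some `j ∈ Y` that contains no other vertex of `X` or
of `Y`. -/
def IsProperForwardTrek (G : DAG V) (X Y : Set V) (p : List V) : Prop :=
  ∃ i ∈ X, ∃ j ∈ Y, G.IsForwardTrek p i j ∧ ∀ k ∈ p, k ∈ X ∨ k ∈ Y → k = i ∨ k = j

/-- `X` is forward-`t`-separated from `Y` by `Z`. -/
def ForwardTSeparated (G : DAG V) (X Y Z : Set V) : Prop :=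
  ∀ p, G.IsProperForwardTrek X Y p → ∃ k ∈ p, k ∈ Z

/-- A choice, for every vertex `i`, of a singular (that is, repetition-free) word `pa i` made of
the parents of `i`. -/
structure ParentChoice (G : DAG V) where
  pa : V → List V
  nodup : ∀ i, (pa i).Nodup
  mem_pa : ∀ {i j}, j ∈ pa i ↔ G.Adj j i

/-! The subgraph `G_{t → v}`, for two words `t` and `v`. -/

/-- `p` is a directed path that ends in `v` and does not travel toward `t`, that is, does not pass
through or end in `t` (starting in `t` is allowed). -/
def IsEffectPath (G : DAG V) (t v p : List V) : Prop :=
  ∃ i, ∃ j ∈ v, G.IsDirectedPath p i j ∧ ∀ k ∈ p.tail, k ∉ t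

/-- `i` is a vertex of `G_{t → v}`. -/
def EffectVertex (G : DAG V) (t v : List V) (i : V) : Prop :=
  i ∈ t ∨ i ∈ v ∨ ∃ p, G.IsEffectPath t v p ∧ i ∈ p

/-- There is an arrow from `i` to `j` in `G_{t → v}`. -/
def EffectArrow (G : DAG V) (t v : List V) (i j : V) : Prop :=
  ∃ p, G.IsEffectPath t v p ∧ [i, j] <:+: p

theorem EffectArrow.adj {G : DAG V} {t v : List V} {i j : V} (h : G.EffectArrow t v i j) :
    G.Adj i j := by
  obtain ⟨p, ⟨_, _, _, hp, _⟩, hij⟩ := h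
  simpa using hp.chain.infix hij

theorem EffectArrow.left {G : DAG V} {t v : List V} {i j : V} (h : G.EffectArrow t v i j) :
    G.EffectVertex t v i := by
  obtain ⟨p, hp, hij⟩ := h
  exact Or.inr (Or.inr ⟨p, hp, hij.subset (by simp)⟩)

theorem EffectArrow.right {G : DAG V} {t v : List V} {i j : V} (h : G.EffectArrow t v i j) :
    G.EffectVertex t v j := by
  obtain ⟨p, hp, hij⟩ := h
  exact Or.inr (Or.inr ⟨p, hp, hij.subset (by simp)⟩)

/-- A vertex of `t` has no parents in `G_{t → v}`. -/
theorem EffectArrow.right_notMem {G : DAG V} {t v : List V} {i j : V}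
    (h : G.EffectArrow t v i j) : j ∉ t := by
  obtain ⟨p, ⟨_, _, _, _, ht⟩, ⟨l, r, rfl⟩⟩ := h
  apply ht
  cases l <;> simp

/-- All parents in `G` of a vertex of `G_{t → v}` outside `t` are parents in `G_{t → v}`. -/
theorem EffectVertex.effectArrow {G : DAG V} {t v : List V} {i j : V}
    (h : G.EffectVertex t v i) (hi : i ∉ t) (hij : G.Adj j i) : G.EffectArrow t v j i := by
  rcases h with h | h | ⟨p, ⟨a, b, hb, hp, ht⟩, hip⟩
  · exact absurd h hi
  · exact ⟨[j, i], ⟨j, i, h, ⟨by simp, by simpa using hij, rfl, rfl⟩, by simpa using hi⟩,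
      List.infix_rfl⟩
  · obtain ⟨l, r, rfl⟩ := List.append_of_mem hip
    refine ⟨j :: i :: r, ⟨j, b, hb, ⟨by simp, ?_, rfl, ?_⟩, ?_⟩, [], r, rfl⟩
    · have : (i :: r).IsChain G.Adj := hp.chain.infix ⟨l, [], by simp⟩
      simpa [hij] using this
    · have := hp.last
      simpa using this
    · intro k hk
      simp only [List.tail_cons, List.mem_cons] at hk
      rcases hk with rfl | hk
      · exact hi
      · apply ht
        cases l <;> simp [hk]

/-- A finite directed acyclic graph has a topological order: a list of all its vertices in which
no vertex occurs before one of its parents. -/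
theorem exists_topologicalOrder [Finite V] (G : DAG V) :
    ∃ σ : List V, σ.Nodup ∧ (∀ i, i ∈ σ) ∧ σ.Pairwise (fun i j => ¬ G.Adj j i) := by
  classical
  have := Fintype.ofFinite V
  have hr : IsPartialOrder V (Relation.ReflTransGen G.Adj) :=
    { refl := fun _ => .refl
      trans := fun _ _ _ => .trans
      antisymm := by
        intro a b hab hba
        rcases Relation.reflTransGen_iff_eq_or_transGen.1 hab with h | h
        · exact h.symm
        · exact absurd (h.trans_left hba) (G.acyclic a) }
  obtain ⟨s, hs, hrs⟩ := extend_partialOrder (Relation.ReflTransGen G.Adj)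
  refine ⟨Finset.univ.sort s, Finset.sort_nodup _ _, by simp, ?_⟩
  refine ((Finset.pairwise_sort Finset.univ s).and (Finset.sort_nodup Finset.univ s)).imp ?_
  rintro a b ⟨hab, hne⟩ hba
  exact hne (hs.antisymm _ _ hab (hrs _ _ (.single hba)))

/-- A topological order of the vertices. -/
noncomputable def topologicalOrder [Finite V] (G : DAG V) : List V :=
  G.exists_topologicalOrder.choose

end DAG

/-! ### The causal theory: a free strict Markov category -/

section FreeMarkov

variable {V : Type u} {G : DAG V}

/-- Formal morphisms between words, generated by duplicates, discards and the causal mechanisms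
under composition, monoidal product and symmetries. The duplicates and discards on words of other
lengths than one are reduced to the atomic ones by the relations below. -/
inductive CauTerm (P : G.ParentChoice) : List V → List V → Type u
  | id (A : List V) : CauTerm P A A
  | comp {A B C : List V} (f : CauTerm P A B) (g : CauTerm P B C) : CauTerm P A C
  | tensor {A B C D : List V} (f : CauTerm P A B) (g : CauTerm P C D) :
      CauTerm P (A ++ C) (B ++ D)
  | symm (A B : List V) : CauTerm P (A ++ B) (B ++ A)
  | dup (A : List V) : CauTerm P A (A ++ A)
  | disc (A : List V) : CauTerm P A []
  | mech (i : V) : CauTerm P (P.pa i) [i]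

namespace CauTerm

variable {P : G.ParentChoice}

/-- The identity of a word, with the codomain written as an equal word. -/
def cast {A B : List V} (h : A = B) : CauTerm P A B := h ▸ CauTerm.id A

/-- The congruence generated by the axioms of a strict Markov category. -/
inductive Rel : ∀ {A B : List V}, CauTerm P A B → CauTerm P A B → Prop
  -- an equivalence relation, compatible with the operations
  | refl {A B} (f : CauTerm P A B) : Rel f f
  | symm {A B} {f g : CauTerm P A B} : Rel f g → Rel g f
  | trans {A B} {f g h : CauTerm P A B} : Rel f g → Rel g h → Rel f h
  | comp {A B C} {f f' : CauTerm P A B} {g g' : CauTerm P B C} :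
      Rel f f' → Rel g g' → Rel (f.comp g) (f'.comp g')
  | tensor {A B C D} {f f' : CauTerm P A B} {g g' : CauTerm P C D} :
      Rel f f' → Rel g g' → Rel (f.tensor g) (f'.tensor g')
  -- category
  | id_comp {A B} (f : CauTerm P A B) : Rel ((CauTerm.id A).comp f) f
  | comp_id {A B} (f : CauTerm P A B) : Rel (f.comp (CauTerm.id B)) f
  | assoc {A B C D} (f : CauTerm P A B) (g : CauTerm P B C) (h : CauTerm P C D) :
      Rel ((f.comp g).comp h) (f.comp (g.comp h))
  -- strict monoidal category
  | tensor_id (A B) : Rel ((CauTerm.id A).tensor (CauTerm.id B)) (CauTerm.id (A ++ B))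
  | tensor_comp {A B C A' B' C'} (f : CauTerm P A B) (g : CauTerm P B C)
      (f' : CauTerm P A' B') (g' : CauTerm P B' C') :
      Rel ((f.comp g).tensor (f'.comp g')) ((f.tensor f').comp (g.tensor g'))
  | unit_tensor {A B} (f : CauTerm P A B) : Rel ((CauTerm.id []).tensor f) f
  | tensor_unit {A B} (f : CauTerm P A B) :
      Rel ((f.tensor (CauTerm.id [])).comp (cast (List.append_nil B)))
        ((cast (List.append_nil A)).comp f)
  | tensor_assoc {A B C A' B' C'} (f : CauTerm P A A') (g : CauTerm P B B')
      (h : CauTerm P C C') :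
      Rel (((f.tensor g).tensor h).comp (cast (List.append_assoc A' B' C')))
        ((cast (List.append_assoc A B C)).comp (f.tensor (g.tensor h)))
  -- symmetric monoidal category
  | symm_natural {A B A' B'} (f : CauTerm P A A') (g : CauTerm P B B') :
      Rel ((f.tensor g).comp (CauTerm.symm A' B')) ((CauTerm.symm A B).comp (g.tensor f))
  | symm_symm (A B) : Rel ((CauTerm.symm A B).comp (CauTerm.symm B A)) (CauTerm.id (A ++ B))
  | hexagon (A B C) :
      Rel ((cast (List.append_assoc A B C)).comp
          ((CauTerm.symm A (B ++ C)).comp (cast (List.append_assoc B C A))))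
        (((CauTerm.symm A B).tensor (CauTerm.id C)).comp
          ((cast (List.append_assoc B A C)).comp
            ((CauTerm.id B).tensor (CauTerm.symm A C))))
  -- cocommutative comonoids
  | coassoc (A) :
      Rel ((dup A).comp ((CauTerm.id A).tensor (dup A)))
        ((dup A).comp (((dup A).tensor (CauTerm.id A)).comp (cast (List.append_assoc A A A))))
  | counit_left (A) : Rel ((dup A).comp ((disc A).tensor (CauTerm.id A))) (CauTerm.id A)
  | counit_right (A) :
      Rel ((dup A).comp ((CauTerm.id A).tensor (disc A))) (cast (List.append_nil A).symm)
  | cocomm (A) : Rel ((dup A).comp (CauTerm.symm A A)) (dup A)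
  -- duplicates and discards respect the monoidal product
  | dup_tensor (A B) :
      Rel (dup (A ++ B))
        (((dup A).tensor (dup B)).comp
          ((cast (show (A ++ A) ++ (B ++ B) = A ++ ((A ++ B) ++ B) by simp)).comp
            (((CauTerm.id A).tensor ((CauTerm.symm A B).tensor (CauTerm.id B))).comp
              (cast (show A ++ ((B ++ A) ++ B) = (A ++ B) ++ (A ++ B) by simp)))))
  | disc_tensor (A B) : Rel (disc (A ++ B)) ((disc A).tensor (disc B))
  | dup_unit : Rel (dup []) (CauTerm.id [])
  | disc_unit : Rel (disc []) (CauTerm.id [])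
  -- discards are natural
  | disc_natural {A B} (f : CauTerm P A B) : Rel (f.comp (disc B)) (disc A)

/-- A composite of two casts is a cast. -/
theorem Rel.cast_comp_cast {A B C : List V} (h : A = B) (h' : B = C) :
    Rel (P := P) ((cast h).comp (cast h')) (cast (h.trans h')) := by
  subst h h'; exact .id_comp _

theorem Rel.id_tensor_cast (A : List V) {B C : List V} (h : B = C) :
    Rel (P := P) ((CauTerm.id A).tensor (cast h)) (cast (congrArg (A ++ ·) h)) := by
  subst h; exact .tensor_id _ _

theorem Rel.cast_tensor_id {B C : List V} (h : B = C) (A : List V) :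
    Rel (P := P) ((cast h).tensor (CauTerm.id A)) (cast (congrArg (· ++ A) h)) := by
  subst h; exact .tensor_id _ _

instance setoid (A B : List V) : Setoid (CauTerm P A B) where
  r := Rel
  iseqv := ⟨Rel.refl, Rel.symm, Rel.trans⟩

end CauTerm

/-- The causal theory of a directed acyclic graph: the free strict Markov category on the causal
mechanisms `κ i : pa i ⟶ i`. Its objects, called variables, are the words over `V`. -/
def Cau (_P : G.ParentChoice) : Type u := List V

namespace Cau

variable {P : G.ParentChoice}

/-- A word over `V`, as an object of the causal theory. -/
def var (P : G.ParentChoice) (A : List V) : Cau P := A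

instance : Category.{u} (Cau P) where
  Hom A B := Quotient (CauTerm.setoid (P := P) A B)
  id A := Quotient.mk _ (CauTerm.id A)
  comp f g := Quotient.map₂ CauTerm.comp (fun _ _ h _ _ h' => CauTerm.Rel.comp h h') f g
  id_comp := by rintro _ _ ⟨f⟩; exact Quotient.sound (.id_comp f)
  comp_id := by rintro _ _ ⟨f⟩; exact Quotient.sound (.comp_id f)
  assoc := by rintro _ _ _ _ ⟨f⟩ ⟨g⟩ ⟨h⟩; exact Quotient.sound (.assoc f g h)

/-- The morphism represented by a formal morphism. -/
def mk {A B : Cau P} (f : CauTerm P A B) : A ⟶ B :=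
  Quotient.mk _ f

theorem mk_eq {A B : Cau P} {f g : CauTerm P A B} (h : CauTerm.Rel f g) : mk f = mk g :=
  Quotient.sound h

theorem mk_cast {A B : Cau P} (h : A = B) : mk (CauTerm.cast (P := P) h) = eqToHom h := by
  subst h; rfl

/-- Equal words are isomorphic, by the identity. -/
def castIso {A B : Cau P} (h : A = B) : A ≅ B where
  hom := mk (CauTerm.cast h)
  inv := mk (CauTerm.cast h.symm)
  hom_inv_id := mk_eq (CauTerm.Rel.cast_comp_cast h h.symm)
  inv_hom_id := mk_eq (CauTerm.Rel.cast_comp_cast h.symm h)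

theorem castIso_eq_eqToIso {A B : Cau P} (h : A = B) : castIso h = eqToIso h := by
  subst h; rfl

instance : MonoidalCategoryStruct (Cau P) where
  tensorObj A B := List.append (α := V) A B
  tensorUnit := ([] : List V)
  tensorHom f g := Quotient.map₂ CauTerm.tensor (fun _ _ h _ _ h' => CauTerm.Rel.tensor h h') f g
  whiskerLeft A _ _ f :=
    Quotient.map₂ CauTerm.tensor (fun _ _ h _ _ h' => CauTerm.Rel.tensor h h') (𝟙 A) f
  whiskerRight f B :=
    Quotient.map₂ CauTerm.tensor (fun _ _ h _ _ h' => CauTerm.Rel.tensor h h') f (𝟙 B)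
  associator A B C := castIso (List.append_assoc (α := V) A B C)
  leftUnitor A := castIso (List.nil_append (α := V) A)
  rightUnitor A := castIso (List.append_nil (α := V) A)

instance : MonoidalCategory (Cau P) := MonoidalCategory.ofTensorHom
  (id_tensorHom_id := fun A B => mk_eq (CauTerm.Rel.tensor_id A B))
  (id_tensorHom := fun _ _ _ _ => rfl)
  (tensorHom_id := fun _ _ => rfl)
  (tensorHom_comp_tensorHom := by
    rintro _ _ _ _ _ _ ⟨f⟩ ⟨f'⟩ ⟨g⟩ ⟨g'⟩
    exact (mk_eq (CauTerm.Rel.tensor_comp f g f' g')).symm)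
  (associator_naturality := by
    rintro _ _ _ _ _ _ ⟨f⟩ ⟨g⟩ ⟨h⟩
    exact mk_eq (CauTerm.Rel.tensor_assoc f g h))
  (leftUnitor_naturality := by
    rintro _ _ ⟨f⟩
    exact mk_eq (((CauTerm.Rel.comp_id _).trans (CauTerm.Rel.unit_tensor f)).trans
      (CauTerm.Rel.id_comp f).symm))
  (rightUnitor_naturality := by
    rintro _ _ ⟨f⟩
    exact mk_eq (CauTerm.Rel.tensor_unit f))
  (pentagon := fun W X Y Z => mk_eq (
    ((CauTerm.Rel.comp (.cast_tensor_id (List.append_assoc (α := V) W X Y) Z)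
      ((CauTerm.Rel.comp (.refl _) (.id_tensor_cast W (List.append_assoc (α := V) X Y Z))).trans
        (.cast_comp_cast _ _))).trans (.cast_comp_cast _ _)).trans
      (CauTerm.Rel.cast_comp_cast _ _).symm))
  (triangle := fun X Y => mk_eq (
    ((CauTerm.Rel.comp (.refl _)
      (.id_tensor_cast X (List.nil_append (α := V) Y))).trans (.cast_comp_cast _ _)).trans
      (CauTerm.Rel.cast_tensor_id (List.append_nil (α := V) X) Y).symm))

/-- The symmetry `A ⊗ B ≅ B ⊗ A`. -/
def symmIso (A B : Cau P) : A ⊗ B ≅ B ⊗ A where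
  hom := mk (CauTerm.symm A B)
  inv := mk (CauTerm.symm B A)
  hom_inv_id := mk_eq (CauTerm.Rel.symm_symm A B)
  inv_hom_id := mk_eq (CauTerm.Rel.symm_symm B A)

theorem symmIso_hexagon (A B C : Cau P) :
    (α_ A B C).hom ≫ (symmIso A (B ⊗ C)).hom ≫ (α_ B C A).hom =
      (symmIso A B).hom ▷ C ≫ (α_ B A C).hom ≫ B ◁ (symmIso A C).hom :=
  mk_eq (CauTerm.Rel.hexagon (P := P) A B C)

instance : SymmetricCategory (Cau P) where
  braiding := symmIso
  braiding_naturality_right := by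
    rintro A _ _ ⟨f⟩
    exact mk_eq (CauTerm.Rel.symm_natural (CauTerm.id A) f)
  braiding_naturality_left := by
    rintro _ _ ⟨f⟩ A
    exact mk_eq (CauTerm.Rel.symm_natural f (CauTerm.id A))
  hexagon_forward := symmIso_hexagon
  hexagon_reverse A B C := by
    have h : α_ C A B ≪≫ symmIso C (A ⊗ B) ≪≫ α_ A B C =
        whiskerRightIso (symmIso C A) B ≪≫ α_ A C B ≪≫ whiskerLeftIso A (symmIso C B) :=
      Iso.ext (symmIso_hexagon C A B)
    have h' := congrArg Iso.inv h
    simp only [Iso.trans_inv, Category.assoc, whiskerRightIso_inv, whiskerLeftIso_inv] at h'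
    exact h'
  symmetry A B := mk_eq (CauTerm.Rel.symm_symm A B)

/-- The duplicate on a variable. -/
def duplicate (A : Cau P) : A ⟶ A ⊗ A := mk (CauTerm.dup A)

/-- The discard on a variable. -/
def discard (A : Cau P) : A ⟶ 𝟙_ (Cau P) := mk (CauTerm.disc A)

/-- The causal mechanism of an atomic variable. -/
def mechanism (i : V) : var P (P.pa i) ⟶ var P [i] := mk (CauTerm.mech i)

theorem duplicate_tensor (A B : Cau P) :
    duplicate (A ⊗ B) = (duplicate A ⊗ₘ duplicate B) ≫ tensorμ A A B B := by
  refine mk_eq ((CauTerm.Rel.dup_tensor (P := P) A B).trans (.comp (.refl _) (.symm ?_)))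
  refine (CauTerm.Rel.assoc _ _ _).symm.trans ?_
  refine .comp ((CauTerm.Rel.comp (.refl _) (.id_tensor_cast A
    (List.append_assoc (α := V) A B B).symm)).trans (.cast_comp_cast _ _)) ?_
  refine .comp (.refl _) ((CauTerm.Rel.comp (.id_tensor_cast A
    (List.append_assoc (α := V) B A B)) (.refl _)).trans (.cast_comp_cast _ _))

instance (A : Cau P) : ComonObj A where
  counit := discard A
  comul := duplicate A
  counit_comul := mk_eq (CauTerm.Rel.counit_left (P := P) A)
  comul_counit := mk_eq (CauTerm.Rel.counit_right (P := P) A)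
  comul_assoc := mk_eq (CauTerm.Rel.coassoc (P := P) A)

instance (A : Cau P) : IsCommComonObj A where
  comul_comm := mk_eq (CauTerm.Rel.cocomm (P := P) A)

instance : MarkovCategory (Cau P) where
  copy_tensor A B := duplicate_tensor A B
  discard_tensor A B := mk_eq ((CauTerm.Rel.disc_tensor (P := P) A B).trans
    (CauTerm.Rel.comp_id _).symm)
  copy_unit := mk_eq CauTerm.Rel.dup_unit
  discard_unit := mk_eq CauTerm.Rel.disc_unit
  discard_natural := by
    rintro A B ⟨f⟩
    exact mk_eq (CauTerm.Rel.disc_natural f)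

end Cau
end FreeMarkov

/-! ### Causal effects -/

section Effect

variable {V : Type u} {G : DAG V}

/-- A wire of the string diagram `Γ_{[v ‖ t]}`: `(i, some j)` is the wire labelled `i` that leaves
the component of `i` and enters the component of its child `j`, and `(i, none)` is the output wire
labelled `i`. -/
abbrev Wire (V : Type u) : Type u := V × Option V

namespace Cau

/-- The word of the labels of a list of parallel wires. -/
def word (P : G.ParentChoice) (ws : List (Wire V)) : Cau P := ws.map Prod.fst

theorem word_append (P : G.ParentChoice) (ws ws' : List (Wire V)) :
    word P (ws ++ ws') = word P ws ⊗ word P ws' :=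
  List.map_append

/-- The multiplier on the atomic variable `i` whose output wires have the targets `T`. -/
def fan (P : G.ParentChoice) (i : V) : (T : List (Option V)) →
    (var P [i] ⟶ word P (T.map (Prod.mk i)))
  | [] => ε[var P [i]]
  | _ :: T => Δ[var P [i]] ≫ (𝟙 (var P [i]) ⊗ₘ fan P i T)

/-- The morphism `f` in parallel with a wire `w` on its left. -/
def wire {P : G.ParentChoice} (w : Wire V) {ws ws' : List (Wire V)}
    (f : word P ws ⟶ word P ws') : word P (w :: ws) ⟶ word P (w :: ws') :=
  𝟙 (word P [w]) ⊗ₘ f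

/-- The symmetry that exchanges the first two wires. -/
def swap (P : G.ParentChoice) (w w' : Wire V) (ws : List (Wire V)) :
    word P (w :: w' :: ws) ⟶ word P (w' :: w :: ws) :=
  (β_ (word P [w]) (word P [w'])).hom ⊗ₘ 𝟙 (word P ws)

section Route

variable [DecidableEq V]

/-- The composite of symmetries that brings the wire `w` to the front. -/
def pull (P : G.ParentChoice) (w : Wire V) : (ws : List (Wire V)) → w ∈ ws →
    (word P ws ⟶ word P (w :: ws.erase w))
  | [], h => absurd h List.not_mem_nil
  | x :: ws, h =>
    if hx : x = w then (castIso (by rw [hx, List.erase_cons_head])).hom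
    else
      wire x (pull P w ws ((List.mem_cons.1 h).resolve_left (Ne.symm hx))) ≫
        swap P x w (ws.erase w) ≫
        (castIso (by rw [List.erase_cons_tail (by simpa using hx)])).hom

/-- The composite of symmetries that rearranges parallel wires. -/
def route (P : G.ParentChoice) : (ws' ws : List (Wire V)) → ws.Perm ws' →
    (word P ws ⟶ word P ws')
  | [], _, h => (castIso (by rw [h.eq_nil])).hom
  | w :: ws', ws, h =>
    pull P w ws (h.mem_iff.2 List.mem_cons_self) ≫
      wire w (route P ws' (ws.erase w) (by simpa using h.erase w))

end Route

section Diagram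

/-- The input wires of the component `Γ_i`, for `i ∉ t`. -/
def inWires (P : G.ParentChoice) (i : V) : List (Wire V) :=
  (P.pa i).map (fun j => (j, some i))

theorem word_inWires (P : G.ParentChoice) (i : V) : word P (inWires P i) = var P (P.pa i) :=
  (List.map_map ..).trans (List.map_id _)

/-- The output wires of the whole diagram. -/
def outputWires (v : List V) : List (Wire V) := v.map (fun i => (i, none))

theorem word_outputWires (P : G.ParentChoice) (v : List V) :
    word P (outputWires v) = var P v :=
  (List.map_map ..).trans (List.map_id _)

variable [Finite V] [DecidableEq V]

open scoped Classical in
/-- The targets of the output wires of the component `Γ_i`: one for every child of `i` in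
`G_{t → v}`, and an extra one if `i ∈ v`. -/
noncomputable def targets (G : DAG V) (t v : List V) (i : V) : List (Option V) :=
  (G.topologicalOrder.filter (fun j => G.EffectArrow t v i j)).map some ++
    if i ∈ v then [none] else []

/-- The output wires of the component `Γ_i`. -/
noncomputable def outWires (G : DAG V) (t v : List V) (i : V) : List (Wire V) :=
  (targets G t v i).map (Prod.mk i)

/-- The component `Γ_i` for `i ∈ t`: a multiplier. -/
noncomputable def multiplierComponent (P : G.ParentChoice) (t v : List V) (i : V) :
    var P [i] ⟶ word P (outWires G t v i) :=
  fan P i (targets G t v i)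

/-- The component `Γ_i` for `i ∉ t`: the causal mechanism of `i` followed by a multiplier. -/
noncomputable def mechanismComponent (P : G.ParentChoice) (t v : List V) (i : V) :
    word P (inWires P i) ⟶ word P (outWires G t v i) :=
  (castIso (word_inWires P i)).hom ≫ mechanism i ≫ fan P i (targets G t v i)

/-- The components of the letters of a word, in parallel. -/
noncomputable def multiplierComponents (P : G.ParentChoice) (t v : List V) : (l : List V) →
    (var P l ⟶ word P (l.flatMap (outWires G t v)))
  | [] => 𝟙 _
  | i :: l => ((multiplierComponent P t v i ⊗ₘ multiplierComponents P t v l :) :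
        var P (i :: l) ⟶ word P (outWires G t v i) ⊗ word P (l.flatMap (outWires G t v))) ≫
      (castIso (word_append P _ _).symm).hom

/-- The open wires that do not enter the component `Γ_i`. -/
def bypass (i : V) (ws : List (Wire V)) : List (Wire V) :=
  ws.filter (fun w => w.2 ≠ some i)

/-- If the wires entering `Γ_i` are among the open wires `ws`, then `Γ_i` can be attached to them,
and this results in new open wires. -/
noncomputable def attach (P : G.ParentChoice) (t v : List V) (i : V) (ws : List (Wire V))
    (h : ws.Perm (inWires P i ++ bypass i ws)) :
    word P ws ⟶ word P (outWires G t v i ++ bypass i ws) :=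
  route P _ ws h ≫ (castIso (word_append P _ _)).hom ≫
    (mechanismComponent P t v i ⊗ₘ 𝟙 (word P (bypass i ws))) ≫
    (castIso (word_append P _ _).symm).hom

/-- The components `Γ_i`, for `i` in the list, can be attached one after the other to the open
wires `ws`. -/
def Attachable (P : G.ParentChoice) (t v : List V) : List V → List (Wire V) → Prop
  | [], _ => True
  | i :: l, ws => ws.Perm (inWires P i ++ bypass i ws) ∧
      Attachable P t v l (outWires G t v i ++ bypass i ws)

/-- The open wires after the components `Γ_i`, for `i` in the list, have been attached. -/
noncomputable def openWires (G : DAG V) (t v : List V) : List V → List (Wire V) → List (Wire V)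
  | [], ws => ws
  | i :: l, ws => openWires G t v l (outWires G t v i ++ bypass i ws)

/-- Attach the components `Γ_i`, for `i` in the list, one after the other to the open wires. -/
noncomputable def attachAll (P : G.ParentChoice) (t v : List V) : (l : List V) →
    (ws : List (Wire V)) → Attachable P t v l ws → (word P ws ⟶ word P (openWires G t v l ws))
  | [], _, _ => 𝟙 _
  | i :: l, ws, h => attach P t v i ws h.1 ≫ attachAll P t v l _ h.2

open scoped Classical in
/-- The vertices of `G_{t → v}` outside `t`, in topological order. -/
noncomputable def interior (G : DAG V) (t v : List V) : List V :=
  G.topologicalOrder.filter (fun i => G.EffectVertex t v i ∧ i ∉ t)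

theorem mem_targets {t v : List V} {i : V} {τ : Option V} :
    τ ∈ targets G t v i ↔ (∃ j, τ = some j ∧ G.EffectArrow t v i j) ∨ (τ = none ∧ i ∈ v) := by
  have := G.exists_topologicalOrder.choose_spec.2.1
  change ∀ i, i ∈ G.topologicalOrder at this
  unfold targets
  split <;> simp_all [eq_comm, and_comm]

theorem nodup_targets (t v : List V) (i : V) : (targets G t v i).Nodup := by
  have : G.topologicalOrder.Nodup := G.exists_topologicalOrder.choose_spec.1
  unfold targets
  refine List.Nodup.append ((this.filter _).map (Option.some_injective V)) ?_ ?_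
  · split <;> simp
  · split <;> simp

theorem mem_outWires {t v : List V} {i : V} {w : Wire V} :
    w ∈ outWires G t v i ↔ w.1 = i ∧ w.2 ∈ targets G t v i := by
  rcases w with ⟨j, τ⟩
  simp only [outWires, List.mem_map, Prod.mk.injEq]
  constructor
  · rintro ⟨τ', h, rfl, rfl⟩; exact ⟨rfl, h⟩
  · rintro ⟨rfl, h⟩; exact ⟨τ, h, rfl, rfl⟩

theorem nodup_outWires (t v : List V) (i : V) : (outWires G t v i).Nodup :=
  (nodup_targets t v i).map (Prod.mk_right_injective i)

theorem mem_interior {t v : List V} {i : V} :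
    i ∈ interior G t v ↔ G.EffectVertex t v i ∧ i ∉ t := by
  have : ∀ i, i ∈ G.topologicalOrder := G.exists_topologicalOrder.choose_spec.2.1
  simp [interior, this]

/-- The open wires after the components of `t` and of the vertices in `d` have been placed. -/
structure IsOpen (G : DAG V) (t v d : List V) (ws : List (Wire V)) : Prop where
  nodup : ws.Nodup
  mem_iff : ∀ w, w ∈ ws ↔ (w.1 ∈ t ∨ w.1 ∈ d) ∧ w.2 ∈ targets G t v w.1 ∧ ∀ c ∈ d, w.2 ≠ some c

theorem isOpen_initial {t : List V} (v : List V) (ht : t.Nodup) :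
    IsOpen G t v [] (t.flatMap (outWires G t v)) where
  nodup := by
    refine List.nodup_flatMap.2 ⟨fun i _ => nodup_outWires t v i, ht.imp ?_⟩
    intro i j hij w hi hj
    exact hij ((mem_outWires.1 hi).1.symm.trans (mem_outWires.1 hj).1)
  mem_iff w := by
    simp only [List.mem_flatMap, mem_outWires]
    constructor
    · rintro ⟨i, hi, rfl, h⟩; exact ⟨Or.inl hi, h, by simp⟩
    · rintro ⟨h | h, h', -⟩
      · exact ⟨_, h, rfl, h'⟩
      · simp at h

theorem isOpen_step (P : G.ParentChoice) {t v d l : List V} {i : V}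
    (hd : interior G t v = d ++ i :: l) {ws : List (Wire V)} (h : IsOpen G t v d ws) :
    ws.Perm (inWires P i ++ bypass i ws) ∧
      IsOpen G t v (d ++ [i]) (outWires G t v i ++ bypass i ws) := by
  have hnd : (interior G t v).Nodup := G.exists_topologicalOrder.choose_spec.1.filter _
  have hpw : (interior G t v).Pairwise (fun i j => ¬ G.Adj j i) :=
    G.exists_topologicalOrder.choose_spec.2.2.filter _
  have hi : G.EffectVertex t v i ∧ i ∉ t := mem_interior.1 (by simp [hd])
  rw [hd] at hnd hpw
  have hirr : ¬ G.Adj i i := fun h => G.acyclic i (.single h)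
  have hid : i ∉ d := fun h => (List.nodup_append.1 hnd).2.2 i h i (by simp) rfl
  have hdi : ∀ c ∈ d, ¬ G.Adj i c := fun c hc =>
    (List.pairwise_append.1 hpw).2.2 c hc i (by simp)
  have hil : ∀ c ∈ l, ¬ G.Adj c i := fun c hc =>
    (List.pairwise_cons.1 (List.pairwise_append.1 hpw).2.1).1 c hc
  constructor
  · have h1 : (ws.filter (fun w => w.2 = some i)).Perm (inWires P i) := by
      refine (List.perm_ext_iff_of_nodup (h.nodup.filter _)
        ((P.nodup i).map (fun a b hab => congrArg Prod.fst hab))).2 ?_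
      rintro ⟨j, τ⟩
      simp only [List.mem_filter, h.mem_iff, List.mem_map, decide_eq_true_eq,
        Prod.mk.injEq, mem_targets]
      constructor
      · rintro ⟨⟨-, h | h, -⟩, rfl⟩
        · obtain ⟨c, hc, h⟩ := h
          cases hc
          exact ⟨j, P.mem_pa.2 h.adj, rfl, rfl⟩
        · cases h.1
      · rintro ⟨j, hj, rfl, rfl⟩
        have hji := P.mem_pa.1 hj
        have harr := hi.1.effectArrow hi.2 hji
        refine ⟨⟨?_, Or.inl ⟨i, rfl, harr⟩, ?_⟩, rfl⟩
        · by_cases hjt : j ∈ t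
          · exact Or.inl hjt
          · have hj' : j ∈ interior G t v := mem_interior.2 ⟨harr.left, hjt⟩
            rw [hd, List.mem_append, List.mem_cons] at hj'
            rcases hj' with h | rfl | h
            · exact Or.inr h
            · exact absurd hji hirr
            · exact absurd hji (hil _ h)
        · rintro c hc ⟨⟩
          exact hid hc
    refine (List.filter_append_perm (fun w => decide (w.2 = some i)) ws).symm.trans
      (h1.append ?_)
    simp [bypass]
  · constructor
    · refine List.Nodup.append (nodup_outWires t v i) (h.nodup.filter _) ?_
      intro w hw hw'
      have h1 := (mem_outWires.1 hw).1
      have h2 := ((h.mem_iff w).1 (List.mem_of_mem_filter hw')).1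
      rw [h1] at h2
      exact h2.elim hi.2 hid
    · rintro ⟨j, τ⟩
      simp only [List.mem_append, mem_outWires, bypass, List.mem_filter, h.mem_iff,
        List.mem_singleton, decide_eq_true_eq]
      constructor
      · rintro (⟨rfl, h⟩ | ⟨⟨h1, h2, h3⟩, h4⟩)
        · refine ⟨Or.inr (Or.inr rfl), h, ?_⟩
          rintro c hc rfl
          obtain ⟨c', hc', h⟩ | h := mem_targets.1 h
          · cases hc'
            rcases hc with hc | rfl
            · exact hdi c hc h.adj
            · exact hirr h.adj
          · cases h.1
        · refine ⟨by tauto, h2, ?_⟩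
          rintro c (hc | rfl)
          · exact h3 c hc
          · exact h4
      · rintro ⟨h1, h2, h3⟩
        by_cases hj : j = i
        · subst hj; exact Or.inl ⟨rfl, h2⟩
        · exact Or.inr ⟨⟨by tauto, h2, fun c hc => h3 c (Or.inl hc)⟩, h3 i (Or.inr rfl)⟩

theorem attachable_of_isOpen (P : G.ParentChoice) {t v : List V} : ∀ {l d : List V}
    {ws : List (Wire V)}, interior G t v = d ++ l → IsOpen G t v d ws →
      Attachable P t v l ws ∧ IsOpen G t v (interior G t v) (openWires G t v l ws)
  | [], d, ws, hd, h => ⟨trivial, by rw [hd, List.append_nil]; exact h⟩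
  | i :: l, d, ws, hd, h => by
    obtain ⟨h1, h2⟩ := isOpen_step P hd h
    have := attachable_of_isOpen P (l := l) (d := d ++ [i]) (by simp [hd]) h2
    exact ⟨⟨h1, this.1⟩, this.2⟩

theorem attachable_interior (P : G.ParentChoice) {t : List V} (v : List V) (ht : t.Nodup) :
    Attachable P t v (interior G t v) (t.flatMap (outWires G t v)) :=
  (attachable_of_isOpen P (List.nil_append _).symm (isOpen_initial v ht)).1

/-- Once all the components are attached, the open wires are the output wires. -/
theorem openWires_perm (P : G.ParentChoice) {t v : List V} (ht : t.Nodup) (hv : v.Nodup) :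
    (openWires G t v (interior G t v) (t.flatMap (outWires G t v))).Perm (outputWires v) := by
  have h := (attachable_of_isOpen P (List.nil_append _).symm (isOpen_initial (G := G) v ht)).2
  refine (List.perm_ext_iff_of_nodup h.nodup
    (hv.map (fun a b hab => congrArg Prod.fst hab))).2 ?_
  rintro ⟨j, τ⟩
  simp only [h.mem_iff, mem_targets, List.mem_map, Prod.mk.injEq]
  constructor
  · rintro ⟨-, ⟨c, rfl, hc⟩ | ⟨rfl, hj⟩, h3⟩
    · exact absurd rfl (h3 c (mem_interior.2 ⟨hc.right, hc.right_notMem⟩))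
    · exact ⟨j, hj, rfl, rfl⟩
  · rintro ⟨j, hj, rfl, rfl⟩
    refine ⟨?_, Or.inr ⟨rfl, hj⟩, by simp⟩
    by_cases hjt : j ∈ t
    · exact Or.inl hjt
    · exact Or.inr (mem_interior.2 ⟨Or.inr (Or.inl hj), hjt⟩)

/-- The causal effect `[v ‖ t] : t ⟶ v` of a singular variable `t` on a singular variable `v`: the
morphism represented by the string diagram `Γ_{[v ‖ t]}` that is obtained by connecting the wires
of the components `Γ_i`, for `i` in `G_{t → v}`. -/
noncomputable def causalEffect (P : G.ParentChoice) (t v : List V) (ht : t.Nodup)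
    (hv : v.Nodup) : var P t ⟶ var P v :=
  multiplierComponents P t v t ≫
    attachAll P t v (interior G t v) _ (attachable_interior P v ht) ≫
    route P (outputWires v) _ (openWires_perm P ht hv) ≫
    (castIso (word_outputWires P v)).hom

end Diagram
end Cau
end Effect

/-! Separation implies the equation because the two diagrams coincide. A path that ends in `w`,
avoids `u` after its start and meets `v` would contain, after that meeting point, a forward trek
from `v` to `w` that meets `v` and `w` only in its endpoints and avoids `u`. If there is none, the
paths defining the subgraph are the same for `v ++ u` as for `u`
(`ForwardTSeparated.isEffectPath_append_iff`). Hence arrows, targets and interior vertices agree,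
and the components of the letters of `v` have no targets, so they are discards. What remains is to
transport morphisms along equalities of words.

For the converse, the free Markov category is interpreted in sets and functions: every wire carries
a truth value and every mechanism is the disjunction of its inputs (`CauTerm.eval`, sound by
`CauTerm.Rel.eval_eq`). A causal effect computes any valuation that solves these structural
equations outside `t` (`Respects.causalEffect`). Feed true to `v` and false to `u`. On the left, the
solution is reachability from `v` by paths avoiding `u`. On the right, `v` is discarded and the
constant valuation false is a solution. Equality of the outputs says that nothing in `w` is
reachable from `v` avoiding `u`, which gives separation. -/

/-! ### The Boolean model of the causal theory -/

section Evaluation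

variable {V : Type u} {G : DAG V} {P : G.ParentChoice}

namespace CauTerm

/-- The interpretation of a formal morphism on lists of truth values: a causal mechanism becomes
the disjunction of its inputs. -/
def eval : ∀ {A B : List V}, CauTerm P A B → List Prop → List Prop
  | _, _, id _, l => l
  | _, _, comp f g, l => g.eval (f.eval l)
  | _, _, tensor (A := A) f g, l => f.eval (l.take A.length) ++ g.eval (l.drop A.length)
  | _, _, symm A _, l => l.drop A.length ++ l.take A.length
  | _, _, dup _, l => l ++ l
  | _, _, disc _, _ => []
  | _, _, mech _, l => [∃ p ∈ l, p]

theorem eval_id (A : List V) (l : List Prop) : (id (P := P) A).eval l = l := rfl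

theorem eval_comp {A B C : List V} (f : CauTerm P A B) (g : CauTerm P B C) (l : List Prop) :
    (f.comp g).eval l = g.eval (f.eval l) := rfl

theorem eval_dup (A : List V) (l : List Prop) : (dup (P := P) A).eval l = l ++ l := rfl

/-- The lists carry no length in their type, and the Markov axioms hold only for lists as long as
the domain; this keeps the length correct along composites. -/
theorem length_eval {A B : List V} (f : CauTerm P A B) :
    ∀ {l : List Prop}, l.length = A.length → (f.eval l).length = B.length := by
  induction f with
  | id A => exact fun h => h
  | comp f g ihf ihg => exact fun h => ihg (ihf h)
  | tensor f g ihf ihg =>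
    intro l h
    rw [List.length_append] at h
    rw [eval, List.length_append, List.length_append, ihf (by simp [h]), ihg (by simp [h])]
  | symm A B => intro l h; simp [eval] at h ⊢; omega
  | dup A => intro l h; simp [eval, h]
  | disc A => intro l h; rfl
  | mech i => intro l h; rfl

@[simp]
theorem eval_cast {A B : List V} (h : A = B) (l : List Prop) :
    (cast (P := P) h).eval l = l := by
  subst h; rfl

theorem eval_tensor_append {A B C D : List V} (f : CauTerm P A B) (g : CauTerm P C D)
    {l l' : List Prop} (h : l.length = A.length) :
    (f.tensor g).eval (l ++ l') = f.eval l ++ g.eval l' := by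
  simp [eval, ← h]

theorem eval_tensor_map (val : V → Prop) {A B C D : List V} (f : CauTerm P A B)
    (g : CauTerm P C D) (hf : f.eval (A.map val) = B.map val) (hg : g.eval (C.map val) = D.map val) :
    (f.tensor g).eval ((A ++ C).map val) = (B ++ D).map val := by
  rw [List.map_append, List.map_append, eval_tensor_append _ _ (List.length_map _), hf, hg]

theorem eval_symm_append (A B : List V) {l l' : List Prop} (h : l.length = A.length) :
    (symm (P := P) A B).eval (l ++ l') = l' ++ l := by
  simp [eval, ← h]

theorem exists_eq_append {A B : List V} {l : List Prop} (h : l.length = (A ++ B).length) :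
    ∃ l₁ l₂, l₁.length = A.length ∧ l₂.length = B.length ∧ l = l₁ ++ l₂ := by
  rw [List.length_append] at h
  exact ⟨l.take A.length, l.drop A.length, by simp [h], by simp [h],
    (List.take_append_drop _ _).symm⟩

/-- Soundness of the model. Functions between powers of a set, with diagonals as duplicates, satisfy
all the axioms; each case splits the input along the word and computes. -/
theorem Rel.eval_eq {A B : List V} {f g : CauTerm P A B} (h : Rel f g) :
    ∀ {l : List Prop}, l.length = A.length → f.eval l = g.eval l := by
  induction h with
  | refl => intros; rfl
  | symm _ ih => exact fun h => (ih h).symm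
  | trans _ _ ih ih' => exact fun h => (ih h).trans (ih' h)
  | comp _ _ ih ih' =>
    intro l h
    rw [eval, eval, ih h, ih' (length_eval _ h)]
  | tensor _ _ ih ih' =>
    intro l h
    obtain ⟨l₁, l₂, h₁, h₂, rfl⟩ := exists_eq_append h
    rw [eval_tensor_append _ _ h₁, eval_tensor_append _ _ h₁, ih h₁, ih' h₂]
  | tensor_comp f g f' g' =>
    intro l h
    obtain ⟨l₁, l₂, h₁, h₂, rfl⟩ := exists_eq_append h
    rw [eval_tensor_append _ _ h₁, eval, eval, eval, eval_tensor_append _ _ h₁,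
      eval_tensor_append _ _ (length_eval _ h₁)]
  | tensor_id A B =>
    intro l h
    obtain ⟨l₁, l₂, h₁, h₂, rfl⟩ := exists_eq_append h
    rw [eval_tensor_append _ _ h₁]; rfl
  | tensor_unit f =>
    intro l h
    simp only [List.length_append, List.length_nil, Nat.add_zero] at h
    simp [eval, ← h]
  | tensor_assoc f g h =>
    intro l hl
    obtain ⟨l', l₃, h', h₃, rfl⟩ := exists_eq_append hl
    obtain ⟨l₁, l₂, h₁, h₂, rfl⟩ := exists_eq_append h'
    rw [eval, eval, eval_cast, eval_cast, eval_tensor_append _ _ h', eval_tensor_append _ _ h₁,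
      List.append_assoc, List.append_assoc, eval_tensor_append _ _ h₁, eval_tensor_append _ _ h₂]
  | symm_natural f g =>
    intro l h
    obtain ⟨l₁, l₂, h₁, h₂, rfl⟩ := exists_eq_append h
    rw [eval, eval, eval_tensor_append _ _ h₁, eval_symm_append _ _ (length_eval _ h₁),
      eval_symm_append _ _ h₁, eval_tensor_append _ _ h₂]
  | symm_symm A B =>
    intro l h
    obtain ⟨l₁, l₂, h₁, h₂, rfl⟩ := exists_eq_append h
    rw [eval_comp, eval_symm_append _ _ h₁, eval_symm_append _ _ h₂, eval_id]
  | hexagon A B C =>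
    intro l hl
    obtain ⟨l', l₃, h', h₃, rfl⟩ := exists_eq_append hl
    obtain ⟨l₁, l₂, h₁, h₂, rfl⟩ := exists_eq_append h'
    simp only [eval_comp, eval_cast]
    rw [eval_tensor_append _ _ h', eval_symm_append _ _ h₁, List.append_assoc l₁ l₂,
      eval_symm_append _ _ h₁, List.append_assoc l₂ l₁, eval_tensor_append _ _ h₂, eval_id, eval_id,
      eval_symm_append _ _ h₁, List.append_assoc]
  | dup_tensor A B =>
    intro l h
    obtain ⟨l₁, l₂, h₁, h₂, rfl⟩ := exists_eq_append h
    simp only [eval_comp, eval_cast, eval_dup]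
    rw [eval_tensor_append _ _ h₁, eval_dup, eval_dup, List.append_assoc l₁ l₁,
      eval_tensor_append _ _ h₁, ← List.append_assoc l₁ l₂ l₂,
      eval_tensor_append _ _ h, eval_symm_append _ _ h₁, eval_id, eval_id]
    simp
  | counit_right => intro l h; simp [eval, ← h]
  | counit_left => intro l h; simp [eval, ← h]
  | cocomm => intro l h; simp [eval, ← h]
  | coassoc => intro l h; simp [eval, ← h]
  | _ => intro l h; simp_all [eval]

end CauTerm

namespace Cau

/-- The interpretation of a morphism on lists of truth values. -/
def eval {A B : Cau P} (f : A ⟶ B) : ∀ l : List Prop, l.length = List.length (α := V) A →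
    List Prop :=
  Quotient.lift (fun (f : CauTerm P A B) l (_ : l.length = List.length (α := V) A) => f.eval l)
    (fun _ _ h => by funext l hl; exact CauTerm.Rel.eval_eq h hl) f

theorem length_map_label (A : Cau P) (val : V → Prop) :
    (List.map val A).length = List.length (α := V) A := List.length_map _

/-- If the wires of the domain carry the truth values given by their labels, then so do those of
the codomain. -/
def Respects (val : V → Prop) {A B : Cau P} (f : A ⟶ B) : Prop :=
  eval f (List.map val A) (length_map_label A val) = List.map val B

namespace Respects

variable {val : V → Prop}

theorem id (A : Cau P) : Respects val (𝟙 A) := rfl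

theorem comp {A B C : Cau P} {f : A ⟶ B} {g : B ⟶ C} (hf : Respects val f)
    (hg : Respects val g) : Respects val (f ≫ g) := by
  induction f using Quotient.inductionOn with | _ f
  induction g using Quotient.inductionOn with | _ g
  change g.eval (f.eval _) = _
  change f.eval _ = _ at hf
  rw [hf]; exact hg

theorem tensor {A B C D : Cau P} {f : A ⟶ B} {g : C ⟶ D} (hf : Respects val f)
    (hg : Respects val g) : Respects val (f ⊗ₘ g) := by
  induction f using Quotient.inductionOn with | _ f
  induction g using Quotient.inductionOn with | _ g
  exact CauTerm.eval_tensor_map val f g hf hg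

theorem castIso {A B : Cau P} (h : A = B) : Respects val (castIso h).hom := by
  subst h; rfl

theorem braiding (A B : Cau P) : Respects val (β_ A B).hom := by
  change (CauTerm.symm (P := P) A B).eval (List.map val (List.append A B)) =
    List.map val (List.append B A)
  erw [List.map_append, List.map_append]
  exact CauTerm.eval_symm_append _ _ (length_map_label A val)

theorem copy (A : Cau P) : Respects val Δ[A] := (List.map_append (f := val)).symm

theorem discard (A : Cau P) : Respects val ε[A] := rfl

/-- The only generator that constrains the valuation: the others merely copy, delete or permute
values, which depend on labels alone. -/
theorem mechanism {i : V} (h : val i ↔ ∃ j ∈ P.pa i, val j) :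
    Respects val (mechanism (P := P) i) := by
  change [∃ p ∈ (P.pa i).map val, p] = [val i]
  rw [h]
  simp only [List.mem_map, exists_exists_and_eq_and]

theorem fan (i : V) : ∀ T, Respects val (fan P i T)
  | [] => discard _
  | _ :: T => (copy _).comp ((id _).tensor (fan i T))

variable [DecidableEq V]

omit [DecidableEq V] in
theorem wire (w : Wire V) {ws ws' : List (Wire V)} {f : word P ws ⟶ word P ws'}
    (hf : Respects val f) : Respects val (wire w f) :=
  (id _).tensor hf

theorem pull (w : Wire V) : ∀ (ws : List (Wire V)) (h : w ∈ ws), Respects val (pull P w ws h)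
  | [], h => absurd h List.not_mem_nil
  | x :: ws, h => by
    rw [Cau.pull]
    split
    · exact castIso _
    · exact (wire x (pull w ws _)).comp (((braiding _ _).tensor (id _)).comp (castIso _))

theorem route : ∀ (ws' ws : List (Wire V)) (h : ws.Perm ws'), Respects val (route P ws' ws h)
  | [], _, _ => castIso _
  | w :: ws', ws, _ => (pull w ws _).comp (wire w (route ws' (ws.erase w) _))

variable [Finite V]

theorem multiplierComponents (t v : List V) : ∀ l, Respects val (multiplierComponents P t v l)
  | [] => id _
  | i :: l => ((fan i _).tensor (multiplierComponents t v l)).comp (castIso _)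

theorem attachAll {t v : List V} : ∀ {l : List V} {ws : List (Wire V)}
    (h : Attachable P t v l ws), (∀ i ∈ l, val i ↔ ∃ j ∈ P.pa i, val j) →
      Respects val (attachAll P t v l ws h)
  | [], _, _, _ => id _
  | i :: _, ws, h, hl =>
    ((route _ ws h.1).comp ((castIso _).comp
      ((((castIso _).comp ((mechanism (hl i List.mem_cons_self)).comp (fan i _))).tensor
        (id _)).comp (castIso _)))).comp
      (attachAll h.2 fun j hj => hl j (List.mem_cons_of_mem _ hj))

/-- A causal effect evaluates structural equations. -/
theorem causalEffect {t v : List V} (ht : t.Nodup) (hv : v.Nodup)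
    (h : ∀ i ∉ t, val i ↔ ∃ j ∈ P.pa i, val j) : Respects val (causalEffect P t v ht hv) :=
  (multiplierComponents t v t).comp <|
    (attachAll _ fun i hi => h i (mem_interior.1 hi).2).comp <|
      (route _ _ _).comp (castIso _)

end Respects

theorem eval_discard_tensor (A : Cau P) {B C : Cau P} (f : B ⟶ C) (l l' : List Prop)
    (h : (l ++ l').length = List.length (α := V) (A ⊗ B : Cau P)) (hl : l.length = List.length (α := V) A)
    (hl' : l'.length = List.length (α := V) B) :
    eval ((ε[A] ⊗ₘ f) ≫ (λ_ C).hom) (l ++ l') h = eval f l' hl' := by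
  induction f using Quotient.inductionOn with | _ f
  exact (CauTerm.eval_cast _ _).trans (CauTerm.eval_tensor_append (CauTerm.disc _) f hl)

end Cau
end Evaluation

/-! ### Forward treks, effect paths and reachability -/

section Separation

variable {V : Type u} {G : DAG V}

namespace DAG

/-- A path from `X` to a disjoint set `Y` contains a forward trek that meets `X` and `Y` only in
its endpoints. -/
theorem exists_isProperForwardTrek {X Y : Set V} (hXY : Disjoint X Y) (p : List V) {i j : V}
    (hp : p.IsChain G.Adj) (hi : p.head? = some i) (hj : p.getLast? = some j) (hiX : i ∈ X)
    (hjY : j ∈ Y) : ∃ q, q ⊆ p ∧ G.IsProperForwardTrek X Y q := by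
  have hij : i ≠ j := fun h => Set.disjoint_left.1 hXY hiX (h ▸ hjY)
  by_cases h : ∀ k ∈ p, k ∈ X ∨ k ∈ Y → k = i ∨ k = j
  · refine ⟨p, List.Subset.refl p, i, hiX, j, hjY, ⟨hij, ?_, hp, hi, hj⟩, h⟩
    match p with
    | [] => simp at hi
    | [a] => simp_all
    | _ :: _ :: _ => simp
  · push Not at h
    obtain ⟨k, hk, hkXY, hki, hkj⟩ := h
    obtain ⟨l, r, rfl⟩ := List.append_of_mem hk
    -- Cut the path at the extra vertex `k`: keep the part after it if `k` is in `X`, the part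
    -- before it if `k` is in `Y`. Since `k` is not an endpoint, the result is strictly shorter.
    rcases hkXY with hkX | hkY
    · have hl : l ≠ [] := by rintro rfl; simp_all
      have hlen := List.length_pos_of_ne_nil hl
      obtain ⟨q, hq, hq'⟩ := exists_isProperForwardTrek hXY (k :: r)
        (hp.infix ⟨l, [], by simp⟩) rfl (by simpa using hj) hkX hjY
      exact ⟨q, fun a ha => List.mem_append_right _ (hq ha), hq'⟩
    · have hr : r ≠ [] := by rintro rfl; simp_all
      have hlen := List.length_pos_of_ne_nil hr
      obtain ⟨q, hq, hq'⟩ := exists_isProperForwardTrek hXY (l ++ [k])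
        (hp.infix ⟨[], r, by simp⟩) (by cases l <;> simp_all) (by simp) hiX hkY
      refine ⟨q, fun a ha => ?_, hq'⟩
      have := hq ha
      simp only [List.mem_append, List.mem_cons] at this ⊢
      tauto
termination_by p.length
decreasing_by all_goals (simp_all; try omega)

variable {u v w : List V}

/-- If `v` is separated from `w` by `u`, then no path that ends in `w` and does not travel toward
`u` contains a vertex of `v`. -/
theorem ForwardTSeparated.notMem_of_isEffectPath
    (h : G.ForwardTSeparated {i | i ∈ v} {i | i ∈ w} {i | i ∈ u}) (hvu : v.Disjoint u)
    (hvw : v.Disjoint w) {p : List V} (hp : G.IsEffectPath u w p) {k : V} (hkp : k ∈ p) :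
    k ∉ v := by
  intro hkv
  obtain ⟨i, j, hj, hp, ht⟩ := hp
  obtain ⟨l, r, rfl⟩ := List.append_of_mem hkp
  obtain ⟨q, hq, hq'⟩ := exists_isProperForwardTrek (G := G) (X := {i | i ∈ v}) (Y := {i | i ∈ w})
    (Set.disjoint_left.2 fun _ ha hb => hvw ha hb) (k :: r)
    (hp.chain.infix ⟨l, [], by simp⟩) rfl (by simpa using hp.last) hkv hj
  obtain ⟨a, haq, hau⟩ := h q hq'
  -- The blocking vertex is either `k`, which lies in `v` and so not in `u`, or lies after `k`,
  -- hence in the tail of the original path, where `u` is forbidden.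
  rcases List.mem_cons.1 (hq haq) with rfl | har
  · exact hvu hkv hau
  · exact ht a (by cases l <;> simp [har]) hau

theorem ForwardTSeparated.isEffectPath_append_iff
    (h : G.ForwardTSeparated {i | i ∈ v} {i | i ∈ w} {i | i ∈ u}) (hvu : v.Disjoint u)
    (hvw : v.Disjoint w) (p : List V) :
    G.IsEffectPath (v ++ u) w p ↔ G.IsEffectPath u w p := by
  constructor
  · rintro ⟨i, j, hj, hp, ht⟩
    exact ⟨i, j, hj, hp, fun k hk hku => ht k hk (List.mem_append_right _ hku)⟩
  · intro hp
    have ⟨i, j, hj, hp', ht⟩ := hp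
    refine ⟨i, j, hj, hp', fun k hk hku => ?_⟩
    rcases List.mem_append.1 hku with hkv | hku
    · exact h.notMem_of_isEffectPath hvu hvw hp (List.mem_of_mem_tail hk) hkv
    · exact ht k hk hku

theorem ForwardTSeparated.effectArrow_append_iff
    (h : G.ForwardTSeparated {i | i ∈ v} {i | i ∈ w} {i | i ∈ u}) (hvu : v.Disjoint u)
    (hvw : v.Disjoint w) (i j : V) :
    G.EffectArrow (v ++ u) w i j ↔ G.EffectArrow u w i j := by
  simp only [EffectArrow, h.isEffectPath_append_iff hvu hvw]

/-- Enlarging `u` by `v` removes nothing from the interior: a vertex of `v` is neither in `u` nor in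
`w`, nor on an effect path. -/
theorem ForwardTSeparated.effectVertex_append_iff
    (h : G.ForwardTSeparated {i | i ∈ v} {i | i ∈ w} {i | i ∈ u}) (hvu : v.Disjoint u)
    (hvw : v.Disjoint w) (i : V) :
    G.EffectVertex (v ++ u) w i ∧ i ∉ v ++ u ↔ G.EffectVertex u w i ∧ i ∉ u := by
  have hi : i ∈ v → ¬ G.EffectVertex u w i ∨ i ∈ u := by
    intro hiv
    refine or_iff_not_imp_right.2 fun hiu => ?_
    rintro (hi | hi | ⟨p, hp, hi⟩)
    · exact hiu hi
    · exact hvw hiv hi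
    · exact h.notMem_of_isEffectPath hvu hvw hp hi hiv
  simp only [EffectVertex, h.isEffectPath_append_iff hvu hvw, List.mem_append] at hi ⊢
  by_cases i ∈ v <;> by_cases i ∈ u <;> simp_all

/-- `i` can be reached from `v` by a path that avoids `u`. -/
def ReachableAvoiding (G : DAG V) (v u : List V) (i : V) : Prop :=
  ∃ j ∈ v, Relation.ReflTransGen (fun a b => G.Adj a b ∧ b ∉ u) j i

/-- Reachability solves the disjunctive structural equations: outside `v` a path has a last arrow,
and outside `u` any arrow into `i` may be appended. -/
theorem reachableAvoiding_iff {i : V} (hi : i ∉ v ++ u) :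
    G.ReachableAvoiding v u i ↔ ∃ j, G.Adj j i ∧ G.ReachableAvoiding v u j := by
  rw [List.mem_append, not_or] at hi
  constructor
  · rintro ⟨j, hj, hji⟩
    rcases hji.cases_tail with rfl | ⟨b, hjb, hbi⟩
    · exact absurd hj hi.1
    · exact ⟨b, hbi.1, j, hj, hjb⟩
  · rintro ⟨b, hbi, j, hj, hjb⟩
    exact ⟨j, hj, hjb.tail ⟨hbi, hi.2⟩⟩

/-- This makes the input values on `u` false: such a path cannot be trivial, and its last arrow
would enter `u`. -/
theorem not_reachableAvoiding (hvu : v.Disjoint u) {i : V} (hi : i ∈ u) :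
    ¬ G.ReachableAvoiding v u i := by
  rintro ⟨j, hj, hji⟩
  rcases hji.cases_tail with rfl | ⟨b, -, hbi⟩
  · exact hvu hj hi
  · exact hbi.2 hi

/-- If nothing in `w` can be reached from `v` by a path that avoids `u`, then `v` is separated
from `w` by `u`. -/
theorem forwardTSeparated_of_not_reachableAvoiding
    (h : ∀ j ∈ w, ¬ G.ReachableAvoiding v u j) :
    G.ForwardTSeparated {i | i ∈ v} {i | i ∈ w} {i | i ∈ u} := by
  rintro p ⟨i, hi, j, hj, ⟨-, hp⟩, -⟩
  by_contra! hu
  have key : ∀ (p : List V) (i : V), p.IsChain G.Adj → p.head? = some i → p.getLast? = some j →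
      (∀ k ∈ p, k ∉ u) → Relation.ReflTransGen (fun a b => G.Adj a b ∧ b ∉ u) i j := by
    intro p
    induction p with
    | nil => intro i _ hi; simp at hi
    | cons a p ih =>
      intro i hc hi hl hu
      obtain rfl : a = i := by simpa using hi
      cases p with
      | nil =>
        obtain rfl : a = j := by simpa using hl
        exact .refl
      | cons b p =>
        rw [List.isChain_cons_cons] at hc
        exact .head ⟨hc.1, hu b (by simp)⟩
          (ih b hc.2 rfl (by simpa using hl) fun k hk => hu k (List.mem_cons_of_mem _ hk))
  exact h j hj ⟨i, hi, key p i hp.chain hp.head hp.last hu⟩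

end DAG
end Separation

/-! ### Transport of diagrams along equalities of words -/

section Transport

variable {V : Type u} {G : DAG V} {P : G.ParentChoice}

namespace Cau

@[simp]
theorem castIso_rfl {A : Cau P} (h : A = A) : (castIso h).hom = 𝟙 A := rfl

theorem castIso_comp_castIso {A B C : Cau P} (h : A = B) (h' : B = C) :
    (castIso h).hom ≫ (castIso h').hom = (castIso (h.trans h')).hom := by
  subst h h'; simp

theorem fan_comp_castIso {T T' : List (Option V)} (hT : T = T') (i : V) :
    fan P i T ≫ (castIso (by rw [hT])).hom = fan P i T' := by
  subst hT; simp

/-- All objects are variables here, so that the equalities can be substituted; for concrete words of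
wires they cannot. -/
theorem tensor_comp_castIso {A B B' C D D' X X' : Cau P} {f : A ⟶ B} {f' : A ⟶ B'} {g : C ⟶ D}
    {g' : C ⟶ D'} {hB : B = B'} {hD : D = D'} (hf : f ≫ (castIso hB).hom = f')
    (hg : g ≫ (castIso hD).hom = g') (h : B ⊗ D = X) (hX : X = X') (h' : B' ⊗ D' = X') :
    ((f ⊗ₘ g) ≫ (castIso h).hom) ≫ (castIso hX).hom = (f' ⊗ₘ g') ≫ (castIso h').hom := by
  subst hB hD hX h hf hg; simp

theorem discard_nil_tensor {A B : Cau P} (f : A ⟶ B) :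
    ((ε[var P []] ⊗ₘ f) ≫ (λ_ B).hom : 𝟙_ (Cau P) ⊗ A ⟶ B) = f := by
  induction f using Quotient.inductionOn with | _ f
  exact mk_eq ((CauTerm.Rel.comp_id _).trans
    ((CauTerm.Rel.tensor .disc_unit (.refl f)).trans (.unit_tensor f)))

/-- By naturality, discarding `A ⊗ B` amounts to discarding `A` and then `B`. -/
theorem discard_tensor_tensor (A B : Cau P) {C D : Cau P} (f : C ⟶ D) :
    (α_ A B C).hom ≫ (ε[A] ⊗ₘ ((ε[B] ⊗ₘ f) ≫ (λ_ D).hom)) ≫ (λ_ D).hom =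
      (ε[A ⊗ B] ⊗ₘ f) ≫ (λ_ D).hom := by
  rw [← MarkovCategory.discard_natural (ε[A] ▷ B ≫ (λ_ B).hom)]
  simp [MonoidalCategory.tensorHom_def, -MarkovCategory.discard_natural]

theorem discard_tensor_comp (A : Cau P) {B C D : Cau P} (f : B ⟶ C) (g : C ⟶ D) :
    ((ε[A] ⊗ₘ f) ≫ (λ_ C).hom) ≫ g = (ε[A] ⊗ₘ (f ≫ g)) ≫ (λ_ D).hom := by
  simp [MonoidalCategory.tensorHom_def]

/-- The associator has disappeared because it is an identity in the strict category. -/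
theorem discard_cons_tensor (i : V) (l : List V) {l' : List V} {D : Cau P} (f : var P l' ⟶ D) :
    ((ε[var P [i]] ⊗ₘ ((ε[var P l] ⊗ₘ f) ≫ (λ_ D).hom)) ≫ (λ_ D).hom :
        var P [i] ⊗ (var P l ⊗ var P l') ⟶ D) =
      ((ε[var P (i :: l)] ⊗ₘ f) ≫ (λ_ D).hom : var P (i :: l) ⊗ var P l' ⟶ D) :=
  (Category.id_comp _).symm.trans (discard_tensor_tensor (var P [i]) (var P l) f)

variable [DecidableEq V]

/-- The attachment of the mechanism of `i` followed by the multiplier with targets `T`. -/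
def attachTargets (P : G.ParentChoice) (T : List (Option V)) (i : V) (ws : List (Wire V))
    (h : ws.Perm (inWires P i ++ bypass i ws)) :
    word P ws ⟶ word P (T.map (Prod.mk i) ++ bypass i ws) :=
  route P _ ws h ≫ (castIso (word_append P _ _)).hom ≫
    (((castIso (word_inWires P i)).hom ≫ mechanism i ≫ fan P i T) ⊗ₘ 𝟙 (word P (bypass i ws))) ≫
    (castIso (word_append P _ _).symm).hom

theorem attachTargets_comp_castIso {T T' : List (Option V)} (hT : T = T') (i : V)
    (ws : List (Wire V)) (h : ws.Perm (inWires P i ++ bypass i ws)) :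
    attachTargets P T i ws h ≫ (castIso (by rw [hT])).hom = attachTargets P T' i ws h := by
  subst hT; simp

variable [Finite V] {t t' v : List V}

/-- The attachments depend on `t` only through the targets. Routing both sides to the common list
`out` makes the codomains equal, so a cast is needed only at the source. -/
theorem attachAll_comp_route (hT : ∀ i, targets G t v i = targets G t' v i)
    (out : List (Wire V)) : ∀ (l : List V) (ws ws' : List (Wire V)) (hws : ws = ws')
    (h : Attachable P t v l ws) (h' : Attachable P t' v l ws')
    (p : (openWires G t v l ws).Perm out) (p' : (openWires G t' v l ws').Perm out),
    attachAll P t v l ws h ≫ route P out _ p =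
      (castIso (congrArg (word P) hws)).hom ≫ attachAll P t' v l ws' h' ≫ route P out _ p'
  | [], ws, _, rfl, h, h', p, p' => by
    simp only [attachAll, castIso_rfl, Category.id_comp]; rfl
  | i :: l, ws, _, rfl, h, h', p, p' => by
    have e : outWires G t v i ++ bypass i ws = outWires G t' v i ++ bypass i ws := by
      rw [outWires, outWires, hT i]
    have ih := attachAll_comp_route hT out l _ _ e h.2 h'.2 p p'
    rw [castIso_rfl, Category.id_comp]
    -- With the target list as an explicit argument, the equality of targets can be substituted in a
    -- single attachment.
    change (attachTargets P (targets G t v i) i ws h.1 ≫ attachAll P t v l _ h.2) ≫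
      route P out _ p = (attachTargets P (targets G t' v i) i ws h.1 ≫ attachAll P t' v l _ h'.2) ≫
      route P out _ p'
    rw [Category.assoc, Category.assoc]
    refine (congrArg (attachTargets P (targets G t v i) i ws h.1 ≫ ·) ih).trans ?_
    refine (Category.assoc _ _ _).symm.trans ?_
    exact congrArg (· ≫ attachAll P t' v l _ h'.2 ≫ route P out _ p')
      (attachTargets_comp_castIso (hT i) i ws h.1)

theorem multiplierComponents_comp_castIso (hT : ∀ i, targets G t v i = targets G t' v i) :
    ∀ (l : List V) (h : word P (l.flatMap (outWires G t v)) = word P (l.flatMap (outWires G t' v))),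
      multiplierComponents P t v l ≫ (castIso h).hom = multiplierComponents P t' v l
  | [], _ => Category.id_comp _
  | i :: l, h => by
    have e : outWires G t v = outWires G t' v := by
      funext i; rw [outWires, outWires, hT i]
    exact tensor_comp_castIso (fan_comp_castIso (hT i) i)
      (multiplierComponents_comp_castIso hT l (by rw [e])) _ h _

/-- A multiplier without targets is a discard by definition of `fan`; the discards of the letters of
`l` combine to the discard of the word. -/
theorem multiplierComponents_append_comp_castIso : ∀ (l l' : List V)
    (_ : ∀ i ∈ l, targets G t v i = [])
    (h : word P ((l ++ l').flatMap (outWires G t v)) = word P (l'.flatMap (outWires G t v))),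
      multiplierComponents P t v (l ++ l') ≫ (castIso h).hom =
        (ε[var P l] ⊗ₘ multiplierComponents P t v l') ≫ (λ_ _).hom
  | [], l', _, _ => (Category.comp_id _).trans (discard_nil_tensor _).symm
  | i :: l, l', hl, h => by
    have e : ∀ i ∈ l, outWires G t v i = [] := fun i hi => by
      rw [outWires, hl i (List.mem_cons_of_mem _ hi), List.map_nil]
    have ih := multiplierComponents_append_comp_castIso l l'
      (fun i hi => hl i (List.mem_cons_of_mem _ hi))
      (by rw [List.flatMap_append, List.flatMap_eq_nil_iff.2 e, List.nil_append])
    refine (tensor_comp_castIso (fan_comp_castIso (hl i List.mem_cons_self) i) ih _ h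
      (List.nil_append _)).trans ?_
    exact discard_cons_tensor i l (multiplierComponents P t v l')

end Cau
end Transport

/-! ### The two directions of the equivalence -/

section CausalEffect

variable {V : Type u} [Finite V] [DecidableEq V] {G : DAG V} {P : G.ParentChoice} {u v w : List V}

namespace Cau

theorem causalEffect_append_of_forwardTSeparated (hu : u.Nodup) (hv : v.Nodup) (hw : w.Nodup)
    (hvu : v.Disjoint u) (hvw : v.Disjoint w)
    (h : G.ForwardTSeparated {i | i ∈ v} {i | i ∈ w} {i | i ∈ u}) :
    causalEffect P (v ++ u) w (hv.append hu hvu) hw =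
      (ε[var P v] ⊗ₘ causalEffect P u w hu hw) ≫ (λ_ (var P w)).hom := by
  have hT : ∀ i, targets G (v ++ u) w i = targets G u w i := fun i => by
    unfold targets
    congr 2
    exact List.filter_congr fun j _ => decide_eq_decide.2 (h.effectArrow_append_iff hvu hvw i j)
  have hI : interior G (v ++ u) w = interior G u w :=
     List.filter_congr fun i _ => decide_eq_decide.2 (h.effectVertex_append_iff hvu hvw i)
  -- A child would put `i` on an effect path, and an output wire would put `i` in `w`; both are
  -- excluded.
  have hv0 : ∀ i ∈ v, targets G (v ++ u) w i = [] := by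
    intro i hi
    rw [List.eq_nil_iff_forall_not_mem]
    intro τ hτ
    rcases mem_targets.1 hτ with ⟨j, -, p, hp, hij⟩ | ⟨-, hiw⟩
    · exact h.notMem_of_isEffectPath hvu hvw ((h.isEffectPath_append_iff hvu hvw p).1 hp)
        (hij.subset (by simp)) hi
    · exact hvw hi hiw
  have hO : outWires G (v ++ u) w = outWires G u w := by
    funext i; rw [outWires, outWires, hT i]
  have hW : (v ++ u).flatMap (outWires G (v ++ u) w) = u.flatMap (outWires G u w) := by
    rw [List.flatMap_append, List.flatMap_eq_nil_iff.2 fun i hi => by rw [outWires, hv0 i hi]; rfl,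
      hO, List.nil_append]
  have hu' : u.flatMap (outWires G (v ++ u) w) = u.flatMap (outWires G u w) := by rw [hO]
  have hM : multiplierComponents P (v ++ u) w (v ++ u) ≫ (castIso (congrArg (word P) hW)).hom =
      (ε[var P v] ⊗ₘ multiplierComponents P u w u) ≫ (λ_ _).hom := by
    have h₁ := multiplierComponents_append_comp_castIso (P := P) v u hv0
      (by rw [hW, hO])
    have h₂ := multiplierComponents_comp_castIso (P := P) hT u (by rw [hO])
    rw [← h₂, ← castIso_comp_castIso (P := P) (congrArg (word P) (hW.trans hu'.symm))
      (congrArg (word P) hu')]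
    refine (Category.assoc _ _ _).symm.trans ((congrArg (· ≫ _) h₁).trans ?_)
    exact discard_tensor_comp _ _ _
  -- The type of `attachAll` and the proofs `a` and `p` depend on the list of vertices, so it is
  -- generalized before being substituted.
  have hA : ∀ l (_ : l = interior G u w)
      (a : Attachable P (v ++ u) w l ((v ++ u).flatMap (outWires G (v ++ u) w)))
      (p : (openWires G (v ++ u) w l ((v ++ u).flatMap (outWires G (v ++ u) w))).Perm
        (outputWires w)), attachAll P (v ++ u) w l _ a ≫ route P (outputWires w) _ p =
      (castIso (congrArg (word P) hW)).hom ≫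
        attachAll P u w (interior G u w) _ (attachable_interior P w hu) ≫
          route P (outputWires w) _ (openWires_perm P hu hw) := by
    rintro _ rfl a p
    exact attachAll_comp_route hT _ _ _ _ hW _ _ _ _
  have hA' := hA _ hI (attachable_interior P w (hv.append hu hvu))
    (openWires_perm P (hv.append hu hvu) hw)
  have h₁ : causalEffect P (v ++ u) w (hv.append hu hvu) hw =
      (multiplierComponents P (v ++ u) w (v ++ u) ≫ (castIso (congrArg (word P) hW)).hom) ≫
        attachAll P u w (interior G u w) _ (attachable_interior P w hu) ≫
        route P (outputWires w) _ (openWires_perm P hu hw) ≫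
        (castIso (word_outputWires P w)).hom := by
    rw [causalEffect, ← Category.assoc (attachAll P (v ++ u) w _ _ _), hA']
    simp only [Category.assoc]
  refine h₁.trans ((congrArg (· ≫ _) hM).trans ?_)
  exact discard_tensor_comp _ _ _

theorem forwardTSeparated_of_causalEffect_append (hu : u.Nodup) (hv : v.Nodup) (hw : w.Nodup)
    (hvu : v.Disjoint u)
    (h : causalEffect P (v ++ u) w (hv.append hu hvu) hw =
      (ε[var P v] ⊗ₘ causalEffect P u w hu hw) ≫ (λ_ (var P w)).hom) :
    G.ForwardTSeparated {i | i ∈ v} {i | i ∈ w} {i | i ∈ u} := by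
  -- The first valuation is true on `v`, by trivial paths, and false on `u`.
  have h₁ : Respects (G.ReachableAvoiding v u) (causalEffect P (v ++ u) w (hv.append hu hvu) hw) :=
    Respects.causalEffect _ _ fun i hi => by
      simp only [P.mem_pa, DAG.reachableAvoiding_iff hi]
  -- A disjunction of false inputs is false, also when a vertex has no parents.
  have h₂ : Respects (fun _ => False) (causalEffect P u w hu hw) :=
    Respects.causalEffect _ _ fun i _ => by simp
  have hu' : u.map (G.ReachableAvoiding v u) = u.map fun _ => False :=
    List.map_congr_left fun i hi => eq_false (DAG.not_reachableAvoiding hvu hi)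
  have h₃ : w.map (G.ReachableAvoiding v u) = w.map fun _ => False := by
    refine (h₁.symm.trans ?_).trans h₂
    rw [h]
    -- The input is a variable because the length proof inside `eval` depends on it.
    have hl : ∀ l (hl : l.length = (v ++ u).length)
      (_ : l = v.map (G.ReachableAvoiding v u) ++ u.map fun _ => False),
      eval ((ε[var P v] ⊗ₘ causalEffect P u w hu hw) ≫ (λ_ (var P w)).hom) l hl =
        eval (causalEffect P u w hu hw) (u.map fun _ => False) (List.length_map _) := by
      rintro _ hl rfl
      exact eval_discard_tensor _ _ _ _ _ (List.length_map _) _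
    exact hl _ _ (by rw [← hu', ← List.map_append]; rfl)
  refine DAG.forwardTSeparated_of_not_reachableAvoiding fun j hj hr => ?_
  exact (List.map_inj_left.1 h₃ j hj).mp hr

end Cau
end CausalEffect

theorem mainTheorem2 {V : Type u} [Finite V] [DecidableEq V] (G : DAG V) (P : G.ParentChoice)
    (u v w : List V) (hu : u.Nodup) (hv : v.Nodup) (hw : w.Nodup)
    (hvu : v.Disjoint u) (hvw : v.Disjoint w) (huw : u.Disjoint w) :
    Cau.causalEffect P (v ++ u) w (hv.append hu hvu) hw =
        (ε[Cau.var P v] ⊗ₘ Cau.causalEffect P u w hu hw) ≫ (λ_ (Cau.var P w)).hom ↔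
      G.ForwardTSeparated {i | i ∈ v} {i | i ∈ w} {i | i ∈ u} :=
  ⟨Cau.forwardTSeparated_of_causalEffect_append hu hv hw hvu,
    Cau.causalEffect_append_of_forwardTSeparated hu hv hw hvu hvw⟩
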